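/- Let $S$ be a numerical semigroup, that is, a submonoid of $(\mathbb{N},+)$ with finite complement in $\mathbb{N}=\{0,1,2,\dots\}$, and assume $S\neq\mathbb{N}$. Let $\{n_1,\dots,n_e\}$ be its minimal system of generators (the set of its atoms), and $\mathrm{e}(S)=e$. For $x\in\mathbb{N}^e$ put $\varphi(x)=\sum_i x_in_i$. For $m\in S$, the elements of $\mathrm{Z}(m)=\varphi^{-1}(m)$ are the factorizations of $m$, and $\nabla_m$ is the graph with vertex set $\mathrm{Z}(m)$ in which two distinct factorizations $x,y$ are joined if and only if $x\cdot y\neq 0$. The element $m$ is a Betti element of $S$ if $\nabla_m$ has at least two connected components. A factorization $x\in\mathrm{Z}(m)$ is isolated if $x\cdot y=0$ for every $y\in\mathrm{Z}(m)$ with $y\ne x$, and $\mathrm{i}_b(S)$ is the number of isolated factorizations of Betti elements of $S$. For a minimal generator $n_j$ let $\mathrm{Ap}(S;n_j)=S\setminus(n_j+S)$; for every $i$ let $c_i=\min\{k\in\mathbb{Z}^+ : kn_i\in\langle n_l : l\neq i\rangle\}$, and for $i\neq j$ let $\alpha_i^{(j)}=\max\{h\in\mathbb{Z}^+ : hn_i\in\mathrm{Ap}(S;n_j)\}$.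 The semigroup $S$ is $c$-rectangular for $n_j$ if \[\mathrm{Ap}(S;n_j)=\Big\{\sum_{i\neq j}\lambda_in_i : \lambda_i\in\mathbb{N},\ 0\le\lambda_i<c_i\Big\},\] and $\alpha$-rectangular for $n_j$ if \[\mathrm{Ap}(S;n_j)=\Big\{\sum_{i\neq j}\lambda_in_i : \lambda_i\in\mathbb{N},\ 0\le\lambda_i\le\alpha_i^{(j)}\Big\}.\] Then the following statements are equivalent: (a) $S$ has exactly one Betti element; (b) $S$ is $c$-rectangular for each of its minimal generators, and $\mathrm{i}_b(S)=\mathrm{e}(S)$; (c) $S$ is $\alpha$-rectangular for each of its minimal generators. -/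

import Mathlib

namespace NumSemigroup

/-- The set of atoms of a submonoid `S` of `ℕ`, i.e. of the irreducible elements of the monoid `S`.
For a numerical semigroup this is its minimal system of generators. -/
def atoms (S : AddSubmonoid ℕ) : Set ℕ :=
  {a | ∃ h : a ∈ S, AddIrreducible (⟨a, h⟩ : S)}

/-- The embedding dimension `e(S)`. -/
noncomputable def embDim (S : AddSubmonoid ℕ) : ℕ∞ := (atoms S).encard

/-- The factorization homomorphism `φ : ℕ^(A) → S`, `φ(x) = ∑ x_a a`, where `A` is the set of
atoms of `S`. -/
def phi (S : AddSubmonoid ℕ) (x : atoms S →₀ ℕ) : ℕ := x.sum fun a k => k * (a : ℕ)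

/-- The dot product on `ℕ^(A)`. -/
def dot {S : AddSubmonoid ℕ} (x y : atoms S →₀ ℕ) : ℕ := x.sum fun a k => k * y a

/-- The set `Z(m)` of factorizations of `m`. -/
def factorizations (S : AddSubmonoid ℕ) (m : ℕ) : Set (atoms S →₀ ℕ) := {x | phi S x = m}

/-- The graph `∇_m` on the factorizations of `m`; its connected components are the R-classes. -/
def nabla (S : AddSubmonoid ℕ) (m : ℕ) : SimpleGraph (factorizations S m) :=
  SimpleGraph.fromRel fun x y => dot x.1 y.1 ≠ 0

/-- The set of Betti elements: those elements of `S` that have at least two R-classes. -/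
def betti (S : AddSubmonoid ℕ) : Set ℕ :=
  {m | m ∈ S ∧ Nontrivial (nabla S m).ConnectedComponent}

/-- The set `I(m)` of isolated factorizations of `m`: those disjoint from every other one. -/
def isolated (S : AddSubmonoid ℕ) (m : ℕ) : Set (atoms S →₀ ℕ) :=
  {x | x ∈ factorizations S m ∧ ∀ y ∈ factorizations S m, y ≠ x → dot x y = 0}

/-- The set `I_b(S)` of the isolated factorizations of the Betti elements of `S`. -/
def isolatedBetti (S : AddSubmonoid ℕ) : Set (atoms S →₀ ℕ) :=
  {x | ∃ m ∈ betti S, x ∈ isolated S m}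

/-- The cardinality `i_b(S)` of `I_b(S)`. -/
noncomputable def ib (S : AddSubmonoid ℕ) : ℕ∞ := (isolatedBetti S).encard

/-- The Apéry set `Ap(S; n) = S \ (n + S)`. -/
def apery (S : AddSubmonoid ℕ) (n : ℕ) : Set ℕ := (S : Set ℕ) \ ((fun s => n + s) '' (S : Set ℕ))

/-- The least positive `k` such that `k * a` lies in the monoid generated by the atoms other
than `a`. -/
noncomputable def cConst (S : AddSubmonoid ℕ) (a : ℕ) : ℕ :=
  sInf {k | 0 < k ∧ k * a ∈ AddSubmonoid.closure (atoms S \ {a})}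

/-- The largest positive `h` such that `h * a` lies in the Apéry set of `n`. -/
noncomputable def alphaConst (S : AddSubmonoid ℕ) (n a : ℕ) : ℕ :=
  sSup {h | 0 < h ∧ h * a ∈ apery S n}

/-- `S` is `c`-rectangular for the atom `n`: the Apéry set of `n` is the set of all sums
`∑ x_a a` over the atoms `a ≠ n`, where `0 ≤ x_a < c_a`. -/
def IsCRectangular (S : AddSubmonoid ℕ) (n : ℕ) : Prop :=
  apery S n = {s | ∃ x : atoms S →₀ ℕ,
    (∀ a : atoms S, ((a : ℕ) = n → x a = 0) ∧ ((a : ℕ) ≠ n → x a < cConst S a)) ∧ s = phi S x}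

/-- `S` is `α`-rectangular for the atom `n`: the Apéry set of `n` is the set of all sums
`∑ x_a a` over the atoms `a ≠ n`, where `0 ≤ x_a ≤ α_a` and `α_a` is relative to `n`. -/
def IsAlphaRectangular (S : AddSubmonoid ℕ) (n : ℕ) : Prop :=
  apery S n = {s | ∃ x : atoms S →₀ ℕ,
    (∀ a : atoms S, ((a : ℕ) = n → x a = 0) ∧ ((a : ℕ) ≠ n → x a ≤ alphaConst S n a)) ∧
      s = phi S x}

end NumSemigroup

/-! All three conditions are equivalent to `IsBettiBox`: the products c_a a share one value b, and
factorizations with every coordinate below c_a are unique. The main tool is `exists_le_isolated`: a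
non-unique factorization dominates a non-unique isolated one, whose value is a Betti element. Each
c_a e_a is isolated of Betti value c_a a. A single Betti element thus forces c_a a = b and leaves no
other isolated factorizations, so the box is unique. Conversely, in a box c_a a may be exchanged for
c_l l, which connects `nabla S m` for m ≠ b and identifies the Apéry sets. For (b) and (c), take b
to be the least value with several factorizations. In (b), counting leaves only the c_a e_a as
isolated factorizations; if b ≠ c_j j, then b avoids j, lies in Ap(j), and rectangularity gives it a
factorization in the unique box. In (c), Apéry elements factor uniquely, so every j occurs in a
factorization of b, and minimality makes that factorization c_j e_j. -/

namespace NumSemigroup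

/-! ### Factorizations, isolated factorizations and Betti elements -/

section Basic

variable {S : AddSubmonoid ℕ}

lemma phi_add (x y : atoms S →₀ ℕ) : phi S (x + y) = phi S x + phi S y :=
  Finsupp.sum_add_index' (by simp) (by intros; ring)

@[simp] lemma phi_zero : phi S 0 = 0 := Finsupp.sum_zero_index

@[simp] lemma phi_single (a : atoms S) (k : ℕ) : phi S (Finsupp.single a k) = k * (a : ℕ) :=
  Finsupp.sum_single_index (by simp)

lemma dot_ne_zero_iff {x y : atoms S →₀ ℕ} : dot x y ≠ 0 ↔ ∃ a, x a ≠ 0 ∧ y a ≠ 0 := by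
  simp [dot, Finsupp.sum, Finset.sum_eq_zero_iff]

lemma atom_mem (a : atoms S) : (a : ℕ) ∈ S := a.2.1

lemma atom_pos (a : atoms S) : 0 < (a : ℕ) := by
  obtain ⟨a, h, hi⟩ := a
  rcases Nat.eq_zero_or_pos a with rfl | h0
  · exact absurd isAddUnit_zero hi.not_isAddUnit
  · exact h0

lemma phi_mem (x : atoms S →₀ ℕ) : phi S x ∈ S :=
  AddSubmonoid.sum_mem _ fun a _ => by
    simpa using S.nsmul_mem (atom_mem a) (x a)

lemma exists_eq_single_add {x : atoms S →₀ ℕ} {a : atoms S} {k : ℕ} (h : k ≤ x a) :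
    ∃ z, x = Finsupp.single a k + z :=
  le_iff_exists_add.1 (by simpa [Finsupp.single_le_iff] using h)

lemma exists_apply_ne_zero {x : atoms S →₀ ℕ} (h : x ≠ 0) : ∃ a, x a ≠ 0 := by
  by_contra! h'
  exact h (Finsupp.ext h')

lemma phi_eq_zero {x : atoms S →₀ ℕ} (h : phi S x = 0) : x = 0 := by
  by_contra h0
  obtain ⟨a, ha⟩ := exists_apply_ne_zero h0
  obtain ⟨z, rfl⟩ := exists_eq_single_add (Nat.one_le_iff_ne_zero.2 ha)
  rw [phi_add, phi_single] at h
  have := atom_pos a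
  omega

lemma isAddUnit_iff (s : S) : IsAddUnit s ↔ (s : ℕ) = 0 := by
  constructor
  · rintro ⟨u, rfl⟩
    have := congrArg (Subtype.val) u.add_neg
    simp only [AddSubmonoid.coe_add, AddSubmonoid.coe_zero] at this
    omega
  · intro h
    have : s = 0 := Subtype.ext h
    exact this ▸ isAddUnit_zero

lemma exists_phi_eq {m : ℕ} (hm : m ∈ S) : ∃ x, phi S x = m := by
  induction m using Nat.strong_induction_on with
  | _ m ih =>
    by_cases h0 : m = 0
    · exact ⟨0, by simp [h0]⟩
    by_cases ha : m ∈ atoms S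
    · exact ⟨Finsupp.single ⟨m, ha⟩ 1, by simp⟩
    have : ∃ s t : S, m = s + t ∧ (s : ℕ) ≠ 0 ∧ (t : ℕ) ≠ 0 := by
      by_contra! hc
      refine ha ⟨hm, ⟨by rwa [isAddUnit_iff], fun {s t} h => ?_⟩⟩
      rw [isAddUnit_iff, isAddUnit_iff]
      by_contra! hst
      exact hst.2 (hc s t (congrArg Subtype.val h) hst.1)
    obtain ⟨s, t, rfl, hs, ht⟩ := this
    obtain ⟨x, hx⟩ := ih s (by omega) s.2
    obtain ⟨y, hy⟩ := ih t (by omega) t.2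
    exact ⟨x + y, by rw [phi_add, hx, hy]⟩

lemma mem_closure_diff_iff {a : atoms S} {m : ℕ} :
    m ∈ AddSubmonoid.closure (atoms S \ {(a : ℕ)}) ↔ ∃ x, x a = 0 ∧ phi S x = m := by
  constructor
  · intro h
    induction h using AddSubmonoid.closure_induction with
    | mem s hs =>
      refine ⟨Finsupp.single ⟨s, hs.1⟩ 1, Finsupp.single_eq_of_ne fun h => hs.2 ?_, by simp⟩
      simp [h]
    | zero => exact ⟨0, by simp⟩
    | add s t _ _ hs ht =>
      obtain ⟨x, hx, rfl⟩ := hs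
      obtain ⟨y, hy, rfl⟩ := ht
      exact ⟨x + y, by simp [hx, hy], phi_add x y⟩
  · rintro ⟨x, hx, rfl⟩
    refine AddSubmonoid.sum_mem _ fun i hi => ?_
    have : (i : ℕ) ∈ atoms S \ {(a : ℕ)} := by
      refine ⟨i.2, fun h => Finsupp.mem_support_iff.1 hi ?_⟩
      rwa [Subtype.ext h]
    simpa using AddSubmonoid.nsmul_mem _ (AddSubmonoid.subset_closure this) (x i)

/-- An element lies in the Apéry set of the atom `j` iff no factorization of it involves `j`. -/
lemma phi_mem_apery_iff {x : atoms S →₀ ℕ} {j : atoms S} :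
    phi S x ∈ apery S j ↔ ∀ y, phi S y = phi S x → y j = 0 := by
  constructor
  · intro h y hy
    by_contra hj
    obtain ⟨z, rfl⟩ := exists_eq_single_add (Nat.one_le_iff_ne_zero.2 hj)
    exact h.2 ⟨phi S z, phi_mem z, by simpa [phi_add] using hy⟩
  · refine fun h => ⟨phi_mem x, ?_⟩
    rintro ⟨s, hs, hsx⟩
    obtain ⟨z, rfl⟩ := exists_phi_eq hs
    have := h (Finsupp.single j 1 + z) (by simpa [phi_add] using hsx)
    simp at this

/-- `x` is the only factorization of the element `φ(x)`. -/
def IsUniqueFactorization (x : atoms S →₀ ℕ) : Prop := ∀ y, phi S y = phi S x → y = x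

lemma IsUniqueFactorization.of_le {x z : atoms S →₀ ℕ} (h : IsUniqueFactorization x)
    (hz : z ≤ x) : IsUniqueFactorization z := by
  obtain ⟨w, rfl⟩ := le_iff_exists_add.1 hz
  intro y hy
  exact add_right_cancel (h (y + w) (by rw [phi_add, phi_add, hy]))

/-- If x meets another factorization in an atom, cancelling that atom keeps non-uniqueness and
lowers the value, so the descent ends at an isolated factorization. -/
lemma exists_le_isolated {x : atoms S →₀ ℕ} (hx : ¬ IsUniqueFactorization x) :
    ∃ z ≤ x, ¬ IsUniqueFactorization z ∧ z ∈ isolated S (phi S z) := by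
  induction hm : phi S x using Nat.strong_induction_on generalizing x with
  | _ m ih =>
    by_cases hi : x ∈ isolated S (phi S x)
    · exact ⟨x, le_rfl, hx, hi⟩
    have : ∃ y, phi S y = phi S x ∧ y ≠ x ∧ dot x y ≠ 0 := by
      by_contra! hc
      exact hi ⟨rfl, fun y hy => hc y hy⟩
    obtain ⟨y, hy, hne, hd⟩ := this
    obtain ⟨a, hxa, hya⟩ := dot_ne_zero_iff.1 hd
    obtain ⟨u, rfl⟩ := exists_eq_single_add (Nat.one_le_iff_ne_zero.2 hxa)
    obtain ⟨v, rfl⟩ := exists_eq_single_add (Nat.one_le_iff_ne_zero.2 hya)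
    rw [phi_add, phi_add] at hy
    have hu : ¬ IsUniqueFactorization u := fun h =>
      hne (congrArg _ (h v (Nat.add_left_cancel hy)))
    have hlt : phi S u < m := by
      have := atom_pos a
      rw [phi_add, phi_single] at hm
      omega
    obtain ⟨z, hz, h⟩ := ih _ hlt hu rfl
    exact ⟨z, hz.trans le_add_self, h⟩

lemma reachable_of_common {m : ℕ} {x y : factorizations S m} {a : atoms S}
    (hx : x.1 a ≠ 0) (hy : y.1 a ≠ 0) : (nabla S m).Reachable x y := by
  by_cases h : x = y
  · exact h ▸ SimpleGraph.Reachable.refl _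
  · refine SimpleGraph.Adj.reachable ?_
    rw [nabla, SimpleGraph.fromRel_adj]
    exact ⟨h, Or.inl (dot_ne_zero_iff.2 ⟨a, hx, hy⟩)⟩

lemma exists_not_reachable_of_mem_betti {m : ℕ} (hm : m ∈ betti S) :
    ∃ x y, ¬ (nabla S m).Reachable x y := by
  obtain ⟨c, d, hcd⟩ := hm.2
  induction c using SimpleGraph.ConnectedComponent.ind with | _ x
  induction d using SimpleGraph.ConnectedComponent.ind with | _ y
  exact ⟨x, y, fun h => hcd (SimpleGraph.ConnectedComponent.eq.2 h)⟩

lemma mem_betti_of_isolated {m : ℕ} {x : atoms S →₀ ℕ} (hx : x ∈ isolated S m)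
    (hu : ¬ IsUniqueFactorization x) : m ∈ betti S := by
  obtain ⟨hxm, hi⟩ := hx
  have hxm' : phi S x = m := hxm
  have : ∃ y, phi S y = phi S x ∧ y ≠ x := by
    by_contra! hc
    exact hu hc
  obtain ⟨y, hy, hne⟩ := this
  refine ⟨hxm' ▸ phi_mem x, ?_⟩
  refine ⟨(nabla S m).connectedComponentMk ⟨x, hxm⟩,
    (nabla S m).connectedComponentMk ⟨y, hy.trans hxm'⟩, fun h => ?_⟩
  obtain ⟨w⟩ := SimpleGraph.ConnectedComponent.eq.1 h
  -- The first edge of a path leaving x would contradict that x is isolated.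
  cases w with
  | nil => exact hne rfl
  | @cons _ v _ hadj _ =>
    rw [nabla, SimpleGraph.fromRel_adj] at hadj
    have h0 := hi v.1 v.2 fun h => hadj.1 (Subtype.ext h.symm)
    rcases hadj.2 with h1 | h1
    · exact h1 h0
    · obtain ⟨a, h2, h3⟩ := dot_ne_zero_iff.1 h1
      exact dot_ne_zero_iff.2 ⟨a, h3, h2⟩ h0

/-- Two different factorizations of the least element with several factorizations are disjoint. -/
lemma exists_least_not_unique {x : atoms S →₀ ℕ} (hx : ¬ IsUniqueFactorization x) :
    ∃ b, (∃ y, phi S y = b) ∧ (∀ y, phi S y = b → ¬ IsUniqueFactorization y) ∧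
      (∀ y, phi S y = b → y ∈ isolated S b) ∧
      ∀ y, ¬ IsUniqueFactorization y → b ≤ phi S y := by
  classical
  have hex : ∃ b, ∃ y, phi S y = b ∧ ¬ IsUniqueFactorization y := ⟨_, x, rfl, hx⟩
  obtain ⟨y₀, hy₀, hn⟩ := Nat.find_spec hex
  have hmin : ∀ y, ¬ IsUniqueFactorization y → Nat.find hex ≤ phi S y := fun y hy =>
    Nat.find_min' hex ⟨y, rfl, hy⟩
  have hnu : ∀ y, phi S y = Nat.find hex → ¬ IsUniqueFactorization y := fun y hy h =>
    hn fun z hz => by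
      rw [h z (hz.trans (hy₀.trans hy.symm)), h y₀ (hy₀.trans hy.symm)]
  refine ⟨Nat.find hex, ⟨y₀, hy₀⟩, hnu, fun y hy => ?_, hmin⟩
  -- By minimality, the isolated factorization below y already has value b, so it is y.
  obtain ⟨z, hz, hzn, hzi⟩ := exists_le_isolated (hnu y hy)
  obtain ⟨w, rfl⟩ := le_iff_exists_add.1 hz
  have h1 := hmin z hzn
  rw [phi_add] at hy
  have hw : w = 0 := phi_eq_zero (by omega)
  subst hw
  rw [phi_zero, add_zero] at hy
  rwa [add_zero, ← hy]

end Basic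

/-! ### The constants c_a and the box they bound -/

section Constants

variable {S : AddSubmonoid ℕ} [Nontrivial (atoms S)]

lemma cConst_mem (a : atoms S) :
    0 < cConst S a ∧ cConst S a * a ∈ AddSubmonoid.closure (atoms S \ {(a : ℕ)}) := by
  obtain ⟨j, hj⟩ := exists_ne a
  -- The set is nonempty because j · a = a · j for a second atom j.
  refine Nat.sInf_mem (s := {k | 0 < k ∧ k * (a : ℕ) ∈ AddSubmonoid.closure (atoms S \ {(a : ℕ)})})
    ⟨j, atom_pos j, mem_closure_diff_iff.2 ⟨Finsupp.single j a, ?_, ?_⟩⟩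
  · exact Finsupp.single_eq_of_ne hj.symm
  · rw [phi_single, mul_comm]

lemma cConst_pos (a : atoms S) : 0 < cConst S a := (cConst_mem a).1

lemma exists_phi_eq_cConst (a : atoms S) : ∃ y, y a = 0 ∧ phi S y = cConst S a * a :=
  mem_closure_diff_iff.1 (cConst_mem a).2

omit [Nontrivial (atoms S)] in
lemma cConst_le {a : atoms S} {k : ℕ} (hk : 0 < k) {x : atoms S →₀ ℕ} (hx : x a = 0)
    (h : phi S x = k * a) : cConst S a ≤ k :=
  Nat.sInf_le ⟨hk, mem_closure_diff_iff.2 ⟨x, hx, h⟩⟩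

-- Cancelling the copies of a in y leaves a multiple d · a with d ≤ k written without a; either d =
-- 0 or minimality of c_a forces d = k = c_a.
omit [Nontrivial (atoms S)] in
lemma eq_single_or_of_le_cConst {a : atoms S} {k : ℕ} (hk : k ≤ cConst S a) {y : atoms S →₀ ℕ}
    (hy : phi S y = k * a) : y = Finsupp.single a k ∨ k = cConst S a ∧ y a = 0 := by
  have hsplit := Finsupp.single_add_erase a y
  have hz0 : (y.erase a) a = 0 := Finsupp.erase_same
  set z := y.erase a
  have hphi : y a * a + phi S z = k * a := by
    rw [← hy, ← hsplit, phi_add, phi_single, hsplit]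
  have ha := atom_pos a
  have hle : y a ≤ k := Nat.le_of_mul_le_mul_right (by omega) ha
  obtain ⟨d, rfl⟩ := Nat.exists_eq_add_of_le hle
  have hzd : phi S z = d * a := by
    rw [add_mul] at hphi
    omega
  rcases Nat.eq_zero_or_pos d with rfl | hd
  · left
    rw [zero_mul] at hzd
    rw [phi_eq_zero hzd, add_zero] at hsplit
    simpa using hsplit.symm
  · have := cConst_le hd hz0 hzd
    right
    omega

omit [Nontrivial (atoms S)] in
lemma isUniqueFactorization_single {a : atoms S} {k : ℕ} (hk : k < cConst S a) :
    IsUniqueFactorization (Finsupp.single a k) := fun _ hy =>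
  (eq_single_or_of_le_cConst hk.le (hy.trans (phi_single a k))).resolve_right fun h => hk.ne h.1

lemma not_isUniqueFactorization_single_cConst (a : atoms S) :
    ¬ IsUniqueFactorization (Finsupp.single a (cConst S a)) := by
  obtain ⟨y, hy, h⟩ := exists_phi_eq_cConst a
  intro hu
  have := hu y (by rw [h, phi_single])
  rw [this, Finsupp.single_eq_same] at hy
  exact (cConst_pos a).ne' hy

omit [Nontrivial (atoms S)] in
lemma single_cConst_mem_isolated (a : atoms S) :
    Finsupp.single a (cConst S a) ∈ isolated S (cConst S a * a) := by
  refine ⟨phi_single _ _, fun y hy hne => ?_⟩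
  by_contra hd
  obtain ⟨i, h1, h2⟩ := dot_ne_zero_iff.1 hd
  have hi : i = a := by
    by_contra h
    exact h1 (Finsupp.single_eq_of_ne h)
  subst hi
  rcases eq_single_or_of_le_cConst le_rfl hy with h | h
  · exact hne h
  · exact h2 h.2

lemma cConst_mul_mem_betti (a : atoms S) : cConst S a * a ∈ betti S :=
  mem_betti_of_isolated (single_cConst_mem_isolated a) (not_isUniqueFactorization_single_cConst a)

/-- All the elements `c_a a` coincide with `b`, and a factorization `x` with `x_a < c_a` for every
atom `a` is the only factorization of its value. -/
structure IsBettiBox (S : AddSubmonoid ℕ) (b : ℕ) : Prop where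
  cConst_mul : ∀ a : atoms S, cConst S a * a = b
  unique : ∀ x : atoms S →₀ ℕ, (∀ a : atoms S, x a < cConst S a) → IsUniqueFactorization x

-- Non-uniqueness would put some c_a e_a below x, by `exists_le_isolated` and `H`.
omit [Nontrivial (atoms S)] in
lemma isUniqueFactorization_of_lt_cConst
    (H : ∀ z ∈ isolatedBetti S, ∃ a : atoms S, z = Finsupp.single a (cConst S a))
    {x : atoms S →₀ ℕ} (hx : ∀ a : atoms S, x a < cConst S a) : IsUniqueFactorization x := by
  by_contra hu
  obtain ⟨z, hz, hn, hi⟩ := exists_le_isolated hu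
  obtain ⟨a, ha⟩ := H z ⟨_, mem_betti_of_isolated hi hn, hi⟩
  have h1 := hz a
  rw [ha, Finsupp.single_eq_same] at h1
  exact (hx a).not_ge h1

/-- If `b = c_a a` for every atom `a`, the isolated factorizations of `b` are the obvious ones. -/
lemma eq_single_of_mem_isolated {b : ℕ} (hb : ∀ a : atoms S, cConst S a * a = b)
    {z : atoms S →₀ ℕ} (hz : z ∈ isolated S b) :
    ∃ a : atoms S, z = Finsupp.single a (cConst S a) := by
  have hz0 : z ≠ 0 := by
    rintro rfl
    obtain ⟨a, -⟩ := exists_pair_ne (atoms S)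
    have h1 : phi S 0 = b := hz.1
    rw [phi_zero, ← hb a] at h1
    exact (Nat.mul_pos (cConst_pos a) (atom_pos a)).ne h1
  obtain ⟨a, ha⟩ := exists_apply_ne_zero hz0
  refine ⟨a, ?_⟩
  by_contra hne
  refine dot_ne_zero_iff.2 ⟨a, ha, ?_⟩ (hz.2 (Finsupp.single a (cConst S a)) ?_ (Ne.symm hne))
  · simpa using (cConst_pos a).ne'
  · exact (phi_single _ _).trans (hb a)

/-! ### The box condition, uniqueness of the Betti element and rectangularity -/

lemma isBettiBox_of_betti_unique {b : ℕ} (hb : ∀ m ∈ betti S, m = b) : IsBettiBox S b := by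
  have hc : ∀ a : atoms S, cConst S a * a = b := fun a => hb _ (cConst_mul_mem_betti a)
  refine ⟨hc, fun x hx => isUniqueFactorization_of_lt_cConst ?_ hx⟩
  rintro z ⟨m, hm, hz⟩
  exact eq_single_of_mem_isolated hc (hb m hm ▸ hz)

lemma IsBettiBox.mem_betti {b : ℕ} (h : IsBettiBox S b) : b ∈ betti S := by
  obtain ⟨a, -⟩ := exists_pair_ne (atoms S)
  exact h.cConst_mul a ▸ cConst_mul_mem_betti a

lemma IsBettiBox.eq_of_mem_betti {b : ℕ} (h : IsBettiBox S b) {m : ℕ} (hm : m ∈ betti S) :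
    m = b := by
  by_contra hmb
  obtain ⟨x, y, hxy⟩ := exists_not_reachable_of_mem_betti hm
  obtain ⟨l, -⟩ := exists_pair_ne (atoms S)
  -- Exchanging c_a a for c_l l links u to a factorization using the fixed atom l; the remainder z
  -- is nonzero since m ≠ b, and it supplies the common atom.
  have key : ∀ u v : factorizations S m, u ≠ v →
      ∃ w : factorizations S m, w.1 l ≠ 0 ∧ (nabla S m).Reachable u w := by
    rintro ⟨u, hu⟩ ⟨v, hv⟩ huv
    have hu' : phi S u = m := hu
    have hv' : phi S v = m := hv
    have : ∃ a : atoms S, cConst S a ≤ u a := by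
      by_contra! hc
      exact huv (Subtype.ext (h.unique u hc v (hv'.trans hu'.symm)).symm)
    obtain ⟨a, ha⟩ := this
    obtain ⟨z, rfl⟩ := exists_eq_single_add ha
    rw [phi_add, phi_single, h.cConst_mul] at hu'
    have hz : z ≠ 0 := by
      rintro rfl
      rw [phi_zero] at hu'
      omega
    obtain ⟨k, hk⟩ := exists_apply_ne_zero hz
    refine ⟨⟨Finsupp.single l (cConst S l) + z, ?_⟩, ?_, reachable_of_common (a := k) ?_ ?_⟩
    · change phi S _ = m
      rw [phi_add, phi_single, h.cConst_mul, hu']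
    · have := cConst_pos l
      simp only [Finsupp.add_apply, Finsupp.single_eq_same]
      omega
    · simp only [Finsupp.add_apply]
      omega
    · simp only [Finsupp.add_apply]
      omega
  have hne : x ≠ y := fun e => hxy (e ▸ SimpleGraph.Reachable.refl _)
  obtain ⟨u, hu, hxu⟩ := key x y hne
  obtain ⟨v, hv, hyv⟩ := key y x hne.symm
  exact hxy ((hxu.trans (reachable_of_common hu hv)).trans hyv.symm)

lemma IsBettiBox.lt_cConst_of_mem_apery {b : ℕ} (h : IsBettiBox S b) {j : atoms S}
    {x : atoms S →₀ ℕ} (hx : phi S x ∈ apery S j) (a : atoms S) : x a < cConst S a := by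
  by_contra! hc
  obtain ⟨z, rfl⟩ := exists_eq_single_add hc
  have := phi_mem_apery_iff.1 hx (Finsupp.single j (cConst S j) + z)
    (by simp [phi_add, h.cConst_mul])
  have hj := cConst_pos j
  simp only [Finsupp.add_apply, Finsupp.single_eq_same] at this
  omega

omit [Nontrivial (atoms S)] in
lemma IsBettiBox.phi_mem_apery {b : ℕ} (h : IsBettiBox S b) {j : atoms S}
    {x : atoms S →₀ ℕ} (hj : x j = 0) (hx : ∀ a : atoms S, x a < cConst S a) :
    phi S x ∈ apery S j :=
  phi_mem_apery_iff.2 fun y hy => by rw [h.unique x hx y hy, hj]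

lemma IsBettiBox.isCRectangular {b : ℕ} (h : IsBettiBox S b) (j : atoms S) :
    IsCRectangular S j := by
  ext s
  constructor
  · intro hs
    obtain ⟨x, rfl⟩ := exists_phi_eq hs.1
    refine ⟨x, fun a => ⟨fun haj => ?_, fun _ => h.lt_cConst_of_mem_apery hs a⟩, rfl⟩
    rw [Subtype.ext haj]
    exact phi_mem_apery_iff.1 hs x rfl
  · rintro ⟨x, hx, rfl⟩
    refine h.phi_mem_apery ((hx j).1 rfl) fun a => ?_
    by_cases haj : (a : ℕ) = j
    · rw [(hx a).1 haj]
      exact cConst_pos a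
    · exact (hx a).2 haj

lemma IsBettiBox.alphaConst_eq {b : ℕ} (h : IsBettiBox S b) {j a : atoms S} (haj : a ≠ j) :
    alphaConst S j a = cConst S a - 1 := by
  have hset : {k | 0 < k ∧ k * (a : ℕ) ∈ apery S j} = {k | 0 < k ∧ k < cConst S a} := by
    ext k
    rw [Set.mem_ofPred_eq, Set.mem_ofPred_eq, ← phi_single]
    refine and_congr_right fun _ => ⟨fun hk => ?_, fun hk => ?_⟩
    · simpa using h.lt_cConst_of_mem_apery hk a
    · have h0 : Finsupp.single a k j = 0 := Finsupp.single_eq_of_ne haj.symm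
      exact phi_mem_apery_iff.2 fun _ hy => by rw [isUniqueFactorization_single hk _ hy, h0]
  rw [alphaConst, hset]
  have hbdd : BddAbove {k | 0 < k ∧ k < cConst S a} := ⟨cConst S a, fun k hk => hk.2.le⟩
  refine le_antisymm ?_ ?_
  · exact csSup_le' fun k hk => Nat.le_sub_one_of_lt hk.2
  -- If c_a = 1 the set is empty and `sSup` defaults to 0, the intended value.
  · rcases Nat.eq_zero_or_pos (cConst S a - 1) with h0 | h0
    · rw [h0]
      exact Nat.zero_le _
    · exact le_csSup hbdd ⟨h0, by omega⟩

lemma IsBettiBox.isAlphaRectangular {b : ℕ} (h : IsBettiBox S b) (j : atoms S) :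
    IsAlphaRectangular S j := by
  rw [IsAlphaRectangular, h.isCRectangular j]
  ext s
  refine exists_congr fun x => and_congr_left fun _ => forall_congr' fun a =>
    and_congr_right fun _ => forall_congr' fun haj => ?_
  have := cConst_pos a
  rw [h.alphaConst_eq fun e => haj (congrArg _ e)]
  omega

lemma injective_single_cConst :
    Function.Injective fun a : atoms S => Finsupp.single a (cConst S a) := by
  intro a a' h
  by_contra hne
  have h1 := DFunLike.congr_fun h a
  rw [Finsupp.single_eq_same, Finsupp.single_eq_of_ne hne] at h1
  exact (cConst_pos a).ne' h1

lemma encard_range_single_cConst :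
    (Set.range fun a : atoms S => Finsupp.single a (cConst S a)).encard = embDim S := by
  rw [← Set.image_univ, injective_single_cConst.encard_image, Set.encard_univ, embDim,
    Set.encard]

lemma range_single_cConst_subset :
    (Set.range fun a : atoms S => Finsupp.single a (cConst S a)) ⊆ isolatedBetti S := by
  rintro _ ⟨a, rfl⟩
  exact ⟨_, cConst_mul_mem_betti a, single_cConst_mem_isolated a⟩

lemma IsBettiBox.ib_eq {b : ℕ} (h : IsBettiBox S b) : ib S = embDim S := by
  rw [ib, ← encard_range_single_cConst]
  congr 1
  refine (Set.Subset.antisymm range_single_cConst_subset ?_).symm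
  rintro z ⟨m, hm, hz⟩
  obtain ⟨a, rfl⟩ := eq_single_of_mem_isolated h.cConst_mul (h.eq_of_mem_betti hm ▸ hz)
  exact ⟨a, rfl⟩

/-! ### From rectangularity back to the box condition -/

lemma exists_isBettiBox_of_isCRectangular (hfin : (atoms S).Finite)
    (hrect : ∀ n ∈ atoms S, IsCRectangular S n) (hib : ib S = embDim S) :
    ∃ b, IsBettiBox S b := by
  have heq : isolatedBetti S = Set.range fun a : atoms S => Finsupp.single a (cConst S a) := by
    have hI : (isolatedBetti S).Finite := by
      rw [← Set.encard_lt_top_iff]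
      exact hib.trans_lt hfin.encard_lt_top
    refine (hI.eq_of_subset_of_encard_le' range_single_cConst_subset ?_).symm
    rw [encard_range_single_cConst]
    exact hib.le
  have H : ∀ z ∈ isolatedBetti S, ∃ a : atoms S, z = Finsupp.single a (cConst S a) := by
    intro z hz
    rw [heq] at hz
    exact hz.imp fun _ h => h.symm
  obtain ⟨l, -⟩ := exists_pair_ne (atoms S)
  obtain ⟨b, ⟨y, hy⟩, hn, hi, -⟩ :=
    exists_least_not_unique (not_isUniqueFactorization_single_cConst l)
  have hbetti : b ∈ betti S := mem_betti_of_isolated (hi y hy) (hn y hy)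
  refine ⟨b, fun j => ?_, fun x => isUniqueFactorization_of_lt_cConst H⟩
  by_contra hj
  -- Every factorization of b is isolated, hence some c_k e_k, and k ≠ j because c_j j ≠ b.
  have hap : b ∈ apery S j := by
    rw [← hy, phi_mem_apery_iff]
    intro z hz
    obtain ⟨k, rfl⟩ := H z ⟨b, hbetti, hi z (hz.trans hy)⟩
    refine Finsupp.single_eq_of_ne ?_
    rintro rfl
    rw [phi_single] at hz
    exact hj (hz.trans hy)
  rw [hrect j j.2] at hap
  obtain ⟨x, hx, hbx⟩ := hap
  refine hn x hbx.symm (isUniqueFactorization_of_lt_cConst H fun a => ?_)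
  by_cases haj : (a : ℕ) = j
  · rw [(hx a).1 haj]
    exact cConst_pos a
  · exact (hx a).2 haj

omit [Nontrivial (atoms S)] in
lemma bddAbove_alphaSet (hS : ((S : Set ℕ)ᶜ).Finite) (j a : atoms S) :
    BddAbove {h | 0 < h ∧ h * (a : ℕ) ∈ apery S j} := by
  obtain ⟨N, hN⟩ := hS.bddAbove
  refine ⟨N + j, fun h hh => ?_⟩
  by_contra! hlt
  have h1 : h ≤ h * a := Nat.le_mul_of_pos_right h (atom_pos a)
  refine hh.2.2 ⟨h * a - j, ?_, by dsimp only; omega⟩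
  by_contra hmem
  have := hN hmem
  omega

omit [Nontrivial (atoms S)] in
lemma le_alphaConst_of_mem_apery (hS : ((S : Set ℕ)ᶜ).Finite) {j : atoms S} {x : atoms S →₀ ℕ}
    (hx : phi S x ∈ apery S j) (a : atoms S) : x a ≤ alphaConst S j a := by
  rcases Nat.eq_zero_or_pos (x a) with h0 | h0
  · rw [h0]
    exact Nat.zero_le _
  refine le_csSup (bddAbove_alphaSet hS j a) ⟨h0, ?_⟩
  obtain ⟨z, hz⟩ := exists_eq_single_add (le_refl (x a))
  rw [← phi_single, phi_mem_apery_iff]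
  intro y hy
  have hyz : phi S (y + z) = phi S x := by
    conv_rhs => rw [hz]
    rw [phi_add, phi_add, hy]
  have := phi_mem_apery_iff.1 hx _ hyz
  rw [Finsupp.add_apply] at this
  omega

omit [Nontrivial (atoms S)] in
/-- If `S` is `α`-rectangular for `j`, the elements of the Apéry set of `j` have only one
factorization. -/
lemma IsAlphaRectangular.isUniqueFactorization (hS : ((S : Set ℕ)ᶜ).Finite)
    (hfin : (atoms S).Finite) {j : atoms S} (hr : IsAlphaRectangular S j) {x : atoms S →₀ ℕ}
    (hx : phi S x ∈ apery S j) : IsUniqueFactorization x := by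
  classical
  have : Finite (atoms S) := hfin
  -- The top corner of the box: it dominates every factorization of an Apéry element, so any other
  -- factorization of its own value would lie strictly below it.
  let f : atoms S →₀ ℕ :=
    Finsupp.equivFunOnFinite.symm fun a => if a = j then 0 else alphaConst S j a
  have hfa : ∀ a, f a = if a = j then 0 else alphaConst S j a := fun a => rfl
  have hf : phi S f ∈ apery S j := by
    rw [hr]
    refine ⟨f, fun a => ⟨fun h => ?_, fun h => ?_⟩, rfl⟩
    · rw [hfa, if_pos (Subtype.ext h)]
    · rw [hfa, if_neg fun e => h (congrArg _ e)]
  have hle : ∀ y, phi S y ∈ apery S j → y ≤ f := by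
    intro y hy a
    rw [hfa]
    split_ifs with h
    · rw [h, phi_mem_apery_iff.1 hy y rfl]
    · exact le_alphaConst_of_mem_apery hS hy a
  have hfu : IsUniqueFactorization f := by
    intro y hy
    obtain ⟨z, hz⟩ := le_iff_exists_add.1 (hle y (hy ▸ hf))
    have h1 := hy
    rw [hz, phi_add] at h1
    rw [hz, phi_eq_zero (x := z) (by omega), add_zero]
  exact hfu.of_le (hle x hx)

lemma exists_isBettiBox_of_isAlphaRectangular (hS : ((S : Set ℕ)ᶜ).Finite)
    (hfin : (atoms S).Finite) (hrect : ∀ n ∈ atoms S, IsAlphaRectangular S n) :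
    ∃ b, IsBettiBox S b := by
  have hbox : ∀ (j : atoms S) (x : atoms S →₀ ℕ), x j = 0 → (∀ a : atoms S, x a < cConst S a) →
      IsUniqueFactorization x := by
    intro j x hj hx
    refine (hrect j j.2).isUniqueFactorization hS hfin ?_
    rw [hrect j j.2]
    refine ⟨x, fun a => ⟨fun h => Subtype.ext h ▸ hj, fun h => ?_⟩, rfl⟩
    have hmem : phi S (Finsupp.single a (x a)) ∈ apery S j := by
      have h0 : Finsupp.single a (x a) j = 0 :=
        Finsupp.single_eq_of_ne fun e => h (congrArg _ e.symm)
      exact phi_mem_apery_iff.2 fun y hy => by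
        rw [isUniqueFactorization_single (hx a) y hy, h0]
    simpa using le_alphaConst_of_mem_apery hS hmem a
  have huniq : ∀ x : atoms S →₀ ℕ, (∀ a : atoms S, x a < cConst S a) →
      IsUniqueFactorization x := by
    intro x hx
    by_contra hu
    obtain ⟨z, hz, hn, hi⟩ := exists_le_isolated hu
    have hzb : ∀ a : atoms S, z a < cConst S a := fun a => (hz a).trans_lt (hx a)
    refine hn fun y hy => ?_
    by_contra hne
    have hy0 : y ≠ 0 := by
      rintro rfl
      rw [phi_zero] at hy
      exact hne (phi_eq_zero hy.symm).symm
    -- The isolated z is disjoint from y, so it misses an atom j of y and `hbox` applies at j.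
    obtain ⟨j, hj⟩ := exists_apply_ne_zero hy0
    have hzj : z j = 0 := by
      by_contra h
      exact dot_ne_zero_iff.2 ⟨j, h, hj⟩ (hi.2 y hy hne)
    exact hn (hbox j z hzj hzb)
  obtain ⟨l, -⟩ := exists_pair_ne (atoms S)
  obtain ⟨b, ⟨y, hy⟩, hn, -, hmin⟩ :=
    exists_least_not_unique (not_isUniqueFactorization_single_cConst l)
  refine ⟨b, fun j => ?_, huniq⟩
  -- Otherwise b would lie in the Apéry set of j and factor uniquely.
  have hex : ∃ z, phi S z = b ∧ z j ≠ 0 := by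
    by_contra! hc
    refine hn y hy ((hrect j j.2).isUniqueFactorization hS hfin ?_)
    exact phi_mem_apery_iff.2 fun z hz => hc z (hz.trans hy)
  obtain ⟨z, hz, hzj⟩ := hex
  have : ∃ i : atoms S, cConst S i ≤ z i := by
    by_contra! hc
    exact hn z hz (huniq z hc)
  obtain ⟨i, hi⟩ := this
  obtain ⟨w, rfl⟩ := exists_eq_single_add hi
  have h1 := hmin _ (not_isUniqueFactorization_single_cConst i)
  rw [phi_add] at hz
  have hw : w = 0 := phi_eq_zero (by omega)
  subst hw
  have hij : i = j := by
    by_contra h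
    exact hzj (by simpa using Finsupp.single_eq_of_ne (Ne.symm h))
  subst hij
  simpa using hz

end Constants

/-! ### Finitely many atoms, and at least two -/

lemma finite_atoms {S : AddSubmonoid ℕ} (hS : ((S : Set ℕ)ᶜ).Finite) : (atoms S).Finite := by
  obtain ⟨N, hN⟩ := hS.bddAbove
  have hmem : ∀ m, N < m → m ∈ S := fun m hm => by
    by_contra h
    exact hm.not_ge (hN h)
  refine (Set.finite_Iio (2 * (N + 1))).subset fun a ha => ?_
  obtain ⟨h, hi⟩ := ha
  by_contra hlt
  rw [Set.mem_Iio, not_lt] at hlt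
  have h1 : (⟨a, h⟩ : S) = ⟨N + 1, hmem _ (by omega)⟩ + ⟨a - (N + 1), hmem _ (by omega)⟩ :=
    Subtype.ext (by simp only [AddSubmonoid.coe_add]; omega)
  have := hi.isAddUnit_or_isAddUnit h1
  simp only [isAddUnit_iff] at this
  omega

/-- A single atom would divide two consecutive elements of S, hence equal 1. -/
lemma nontrivial_atoms {S : AddSubmonoid ℕ} (hS : ((S : Set ℕ)ᶜ).Finite) (hne : S ≠ ⊤) :
    Nontrivial (atoms S) := by
  by_contra hc
  rw [not_nontrivial_iff_subsingleton] at hc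
  obtain ⟨N, hN⟩ := hS.bddAbove
  have hmem : ∀ m, N < m → m ∈ S := fun m hm => by
    by_contra h
    exact hm.not_ge (hN h)
  obtain ⟨x, hx⟩ := exists_phi_eq (hmem (N + 1) (by omega))
  obtain ⟨a, -⟩ := exists_apply_ne_zero (x := x) (by rintro rfl; simp at hx)
  have hdvd : ∀ m ∈ S, (a : ℕ) ∣ m := by
    intro m hm
    obtain ⟨y, rfl⟩ := exists_phi_eq hm
    exact Finset.dvd_sum fun i _ => (congrArg Subtype.val (Subsingleton.elim a i)) ▸ dvd_mul_left _ _
  have h1 : (a : ℕ) ∣ 1 := by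
    simpa using Nat.dvd_sub (hdvd (N + 2) (hmem _ (by omega))) (hdvd (N + 1) (hmem _ (by omega)))
  have h2 : 1 ∈ S := Nat.dvd_one.1 h1 ▸ atom_mem a
  exact hne (eq_top_iff.2 fun m _ => by simpa using S.nsmul_mem h2 m)

end NumSemigroup

theorem mainTheorem3 (S : AddSubmonoid ℕ) (hfin : ((S : Set ℕ)ᶜ).Finite) (hS : S ≠ ⊤) :
    List.TFAE [
      (∃! b : ℕ, b ∈ NumSemigroup.betti S),
      (∀ n ∈ NumSemigroup.atoms S, NumSemigroup.IsCRectangular S n) ∧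
        NumSemigroup.ib S = NumSemigroup.embDim S,
      (∀ n ∈ NumSemigroup.atoms S, NumSemigroup.IsAlphaRectangular S n)] := by
  have := NumSemigroup.nontrivial_atoms hfin hS
  have hA := NumSemigroup.finite_atoms hfin
  have h1 : (∃! b : ℕ, b ∈ NumSemigroup.betti S) ↔ ∃ b, NumSemigroup.IsBettiBox S b :=
    ⟨fun ⟨b, _, h⟩ => ⟨b, NumSemigroup.isBettiBox_of_betti_unique h⟩,
      fun ⟨b, h⟩ => ⟨b, h.mem_betti, fun _ hm => h.eq_of_mem_betti hm⟩⟩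
  tfae_have 1 → 2 := fun h => by
    obtain ⟨b, hb⟩ := h1.1 h
    exact ⟨fun n hn => hb.isCRectangular ⟨n, hn⟩, hb.ib_eq⟩
  tfae_have 1 → 3 := fun h => by
    obtain ⟨b, hb⟩ := h1.1 h
    exact fun n hn => hb.isAlphaRectangular ⟨n, hn⟩
  tfae_have 2 → 1 := fun h =>
    h1.2 (NumSemigroup.exists_isBettiBox_of_isCRectangular hA h.1 h.2)
  tfae_have 3 → 1 := fun h =>
    h1.2 (NumSemigroup.exists_isBettiBox_of_isAlphaRectangular hfin hA h)
  tfae_finish
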